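/- Let $\mathcal H_1,\mathcal H_2$ be separable complex Hilbert spaces, let $\mathcal T(\mathcal H)$ and $\mathcal B(\mathcal H)$ denote the trace-class and the bounded operators on $\mathcal H$, and let $\Phi:\mathcal T(\mathcal H_1)\to\mathcal T(\mathcal H_2)$ be a quantum operation, i.e. a linear map, bounded for the trace norm, whose dual $\Phi^*:\mathcal B(\mathcal H_2)\to\mathcal B(\mathcal H_1)$, given by $\operatorname{tr}(\Phi^*(X)T)=\operatorname{tr}(X\Phi(T))$, is normal (ultraweakly continuous) and completely positive. A Stinespring representation of $\Phi$ is a pair $(\mathcal K,A)$ of a separable complex Hilbert space $\mathcal K$ and a bounded operator $A:\mathcal H_1\to\mathcal H_2\otimes\mathcal K$ with $\Phi(T)=\operatorname{tr}_{\mathcal K}(ATA^*)$ for all $T\in\mathcal T(\mathcal H_1)$, where $\operatorname{tr}_{\mathcal K}$ is the partial trace over $\mathcal K$; it is minimal if $\overline{\operatorname{span}}\{(X\otimes I_{\mathcal K})Ah: X\in\mathcal B(\mathcal H_2),\ h\in\mathcal H_1\}=\mathcal H_2\otimes\mathcal K$. (1) Suppose $\mathcal H_2\neq\{0\}$. If $(\widehat{\mathcal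 K},\widehat A)$ is a minimal Stinespring representation of $\Phi$ and $(\mathcal K,A)$ is any Stinespring representation of $\Phi$, then there is an isometry $V:\widehat{\mathcal K}\to\mathcal K$ with $$A=(I_{\mathcal H_2}\otimes V)\widehat A\quad\text{and}\quad \widehat A=(I_{\mathcal H_2}\otimes V^*)A,$$ and $V$ is a unitary if $(\mathcal K,A)$ is also minimal. (2) If $(\mathcal K,A)$ and $(\mathcal K',A')$ are any two Stinespring representations of $\Phi$, then there is a partial isometry $W:\mathcal K\to\mathcal K'$ with $$A'=(I_{\mathcal H_2}\otimes W)A\quad\text{and}\quad A=(I_{\mathcal H_2}\otimes W^*)A'.$$ -/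

import Mathlib

open scoped InnerProductSpace TensorProduct ENNReal NNReal

namespace QOp

noncomputable section

/-! ### Trace-class operators -/

/-- Index set of a chosen orthonormal (Hilbert) basis of `H`. -/
def basisSet (H : Type*) [NormedAddCommGroup H] [InnerProductSpace ℂ H] [CompleteSpace H] : Set H :=
  Classical.choose (exists_hilbertBasis ℂ H)

/-- A chosen orthonormal (Hilbert) basis of `H`. -/
def stdBasis (H : Type*) [NormedAddCommGroup H] [InnerProductSpace ℂ H] [CompleteSpace H] :
    HilbertBasis (basisSet H) ℂ H :=
  Classical.choose (Classical.choose_spec (exists_hilbertBasis ℂ H))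

/-- The trace `∑ ⟪eᵢ, T eᵢ⟫` over an orthonormal basis; for a trace-class `T` the sum converges
absolutely and does not depend on the basis. -/
def trace {H : Type*} [NormedAddCommGroup H] [InnerProductSpace ℂ H] [CompleteSpace H]
    (T : H →L[ℂ] H) : ℂ :=
  ∑' i, ⟪stdBasis H i, T (stdBasis H i)⟫_ℂ

/-- The trace norm `tr |T| ∈ [0, ∞]`, where `|T| = (T* T)^(1/2)`. -/
def traceNorm {H : Type*} [NormedAddCommGroup H] [InnerProductSpace ℂ H] [CompleteSpace H]
    (T : H →L[ℂ] H) : ℝ≥0∞ :=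
  ∑' i, ENNReal.ofReal (RCLike.re ⟪stdBasis H i, (CFC.abs T) (stdBasis H i)⟫_ℂ)

/-- `T` is trace class if `tr |T| < ∞`. -/
def IsTraceClass {H : Type*} [NormedAddCommGroup H] [InnerProductSpace ℂ H] [CompleteSpace H]
    (T : H →L[ℂ] H) : Prop :=
  traceNorm T < ∞

section Helpers

variable {E F G : Type*} [NormedAddCommGroup E] [InnerProductSpace ℂ E] [CompleteSpace E]
  [NormedAddCommGroup F] [InnerProductSpace ℂ F] [CompleteSpace F]
  [NormedAddCommGroup G] [InnerProductSpace ℂ G] [CompleteSpace G]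

open ContinuousLinearMap (adjoint)

/-- The squared Hilbert-Schmidt norm. -/
def hsSq (A : E →L[ℂ] F) : ℝ≥0∞ := ∑' i, ENNReal.ofReal (‖A (stdBasis E i)‖ ^ 2)

theorem parseval (x : E) :
    ENNReal.ofReal (‖x‖ ^ 2) = ∑' i, ENNReal.ofReal (‖⟪stdBasis E i, x⟫_ℂ‖ ^ 2) := by
  have h := (stdBasis E).hasSum_inner_mul_inner x x
  have h2 : HasSum (fun i => ‖⟪stdBasis E i, x⟫_ℂ‖ ^ 2) (‖x‖ ^ 2) := by
    have h3 := RCLike.hasSum_re ℂ h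
    rw [inner_self_eq_norm_sq] at h3
    convert h3 using 2 with i
    rw [← inner_conj_symm x, RCLike.conj_mul]
    norm_cast
  rw [← h2.tsum_eq, ENNReal.ofReal_tsum_of_nonneg (fun i => by positivity) h2.summable]

theorem hsSq_adjoint (A : E →L[ℂ] F) : hsSq (adjoint A) = hsSq A := by
  unfold hsSq
  rw [tsum_congr fun i => parseval (adjoint A (stdBasis F i)),
    tsum_congr fun i => parseval (A (stdBasis E i)), ENNReal.tsum_comm]
  refine tsum_congr fun i => tsum_congr fun j => ?_
  rw [ContinuousLinearMap.adjoint_inner_right, norm_inner_symm]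

theorem hsSq_comp_le (U : F →L[ℂ] G) (A : E →L[ℂ] F) :
    hsSq (U ∘L A) ≤ ENNReal.ofReal (‖U‖ ^ 2) * hsSq A := by
  unfold hsSq
  rw [← ENNReal.tsum_mul_left]
  refine ENNReal.tsum_le_tsum fun i => ?_
  rw [← ENNReal.ofReal_mul (by positivity), ← mul_pow]
  gcongr
  exact U.le_opNorm _

theorem hsSq_comp_le' (A : F →L[ℂ] G) (U : E →L[ℂ] F) :
    hsSq (A ∘L U) ≤ ENNReal.ofReal (‖U‖ ^ 2) * hsSq A := by
  rw [← hsSq_adjoint, ContinuousLinearMap.adjoint_comp, ← hsSq_adjoint A]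
  have := hsSq_comp_le (adjoint U) (adjoint A)
  rwa [LinearIsometryEquiv.norm_map] at this

theorem adjoint_of_nonneg {P : E →L[ℂ] E} (h : 0 ≤ P) : adjoint P = P :=
  ((ContinuousLinearMap.nonneg_iff_isPositive P).1 h).isSelfAdjoint

theorem norm_abs_apply (T : E →L[ℂ] E) (x : E) : ‖CFC.abs T x‖ = ‖T x‖ := by
  have h : ⟪CFC.abs T x, CFC.abs T x⟫_ℂ = ⟪T x, T x⟫_ℂ := by
    have h1 : CFC.abs T * CFC.abs T = star T * T := CFC.abs_mul_abs T
    have h2 := congrArg (fun S : E →L[ℂ] E => ⟪x, S x⟫_ℂ) h1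
    simp only [mul_apply_eq_comp, ContinuousLinearMap.star_eq_adjoint,
      ContinuousLinearMap.adjoint_inner_right] at h2
    rw [← h2, ← ContinuousLinearMap.adjoint_inner_right, adjoint_of_nonneg (CFC.abs_nonneg T)]
  rw [inner_self_eq_norm_sq_to_K, inner_self_eq_norm_sq_to_K] at h
  have h' : ‖CFC.abs T x‖ ^ 2 = ‖T x‖ ^ 2 := by exact_mod_cast h
  exact (sq_eq_sq₀ (norm_nonneg _) (norm_nonneg _)).1 h'

/-- Polar decomposition: `T = U |T|` and `|T| = U* T` for a contraction `U`. -/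
theorem exists_polar (T : E →L[ℂ] E) :
    ∃ U : E →L[ℂ] E, ‖U‖ ≤ 1 ∧ T = U ∘L CFC.abs T ∧ CFC.abs T = adjoint U ∘L T := by
  set P : E →L[ℂ] E := CFC.abs T with hP
  let S : Submodule ℂ E := (LinearMap.range P.toLinearMap).topologicalClosure
  have hmem : ∀ x, P x ∈ S := fun x => Submodule.le_topologicalClosure _ ⟨x, rfl⟩
  let e : E →ₗ[ℂ] S := P.toLinearMap.codRestrict S hmem
  have : CompleteSpace S := (Submodule.isClosed_topologicalClosure _).completeSpace_coe
  have hd : DenseRange e := by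
    rw [DenseRange, Subtype.dense_iff]
    intro x hx
    have : ((fun s : S => (s : E)) '' Set.range e : Set E) = (LinearMap.range P.toLinearMap : Set E) := by
      ext y; constructor
      · rintro ⟨_, ⟨z, rfl⟩, rfl⟩; exact ⟨z, rfl⟩
      · rintro ⟨z, rfl⟩; exact ⟨_, ⟨z, rfl⟩, rfl⟩
    change x ∈ closure ((fun s : S => (s : E)) '' Set.range e)
    rw [this]
    exact hx
  have hn : ∀ x, ‖T.toLinearMap x‖ ≤ 1 * ‖e x‖ := fun x => by
    rw [one_mul]; exact (norm_abs_apply T x).ge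
  let U₀ : S →L[ℂ] E := T.toLinearMap.extendOfNorm e
  have hU₀ : ∀ x, U₀ (e x) = T x := LinearMap.extendOfNorm_eq hd ⟨1, hn⟩
  have hU₀n : ‖U₀‖ ≤ 1 := LinearMap.opNorm_extendOfNorm_le hd zero_le_one hn
  let U : E →L[ℂ] E := U₀ ∘L S.orthogonalProjectionOnto
  have hUP : ∀ x, U (P x) = T x := fun x => by
    have : S.orthogonalProjectionOnto (P x) = e x :=
      Submodule.orthogonalProjectionOnto_mem_subspace_eq_self (e x)
    simp only [U, ContinuousLinearMap.comp_apply, this, hU₀]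
  have hkey : ∀ s : S, ∀ x, ⟪U₀ s, T x⟫_ℂ = ⟪(s : E), P x⟫_ℂ := by
    intro s x
    refine hd.induction_on (p := fun s : S => ⟪U₀ s, T x⟫_ℂ = ⟪(s : E), P x⟫_ℂ) s
      (isClosed_eq (by fun_prop) (by fun_prop)) fun y => ?_
    rw [hU₀]
    change _ = ⟪P y, P x⟫_ℂ
    have h1 : P * P = star T * T := CFC.abs_mul_abs T
    have h2 := congrArg (fun S : E →L[ℂ] E => ⟪y, S x⟫_ℂ) h1
    simp only [mul_apply_eq_comp, ContinuousLinearMap.star_eq_adjoint,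
      ContinuousLinearMap.adjoint_inner_right] at h2
    rw [← h2, ← ContinuousLinearMap.adjoint_inner_right, adjoint_of_nonneg (CFC.abs_nonneg T)]
  refine ⟨U, ?_, ?_, ?_⟩
  · calc ‖U‖ ≤ ‖U₀‖ * ‖S.orthogonalProjectionOnto‖ := ContinuousLinearMap.opNorm_comp_le _ _
      _ ≤ 1 * 1 := by
        gcongr
        exact Submodule.orthogonalProjectionOnto_norm_le S
      _ = 1 := one_mul 1
  · ext x; exact (hUP x).symm
  · ext x
    refine ext_inner_left ℂ fun y => ?_
    rw [ContinuousLinearMap.comp_apply, ContinuousLinearMap.adjoint_inner_right]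
    simp only [U, ContinuousLinearMap.comp_apply]
    rw [hkey]
    exact (Submodule.inner_orthogonalProjectionOnto_eq_of_mem_right ⟨P x, hmem x⟩ y).symm

theorem exists_sqrt (T : E →L[ℂ] E) :
    ∃ R : E →L[ℂ] E, adjoint R = R ∧ R ∘L R = CFC.abs T ∧ traceNorm T = hsSq R := by
  obtain ⟨R, hR, h⟩ : ∃ R : E →L[ℂ] E, adjoint R = R ∧ R ∘L R = CFC.abs T :=
    ⟨CFC.sqrt (CFC.abs T), adjoint_of_nonneg (CFC.sqrt_nonneg (CFC.abs T)),
      CFC.sqrt_mul_sqrt_self (CFC.abs T) (CFC.abs_nonneg T)⟩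
  refine ⟨R, hR, h, ?_⟩
  unfold traceNorm hsSq
  refine tsum_congr fun i => ?_
  rw [← h, ContinuousLinearMap.comp_apply, ← ContinuousLinearMap.adjoint_inner_left, hR,
    inner_self_eq_norm_sq]

theorem sum_inner_le (B A : E →L[ℂ] F) :
    ∑' i, ENNReal.ofReal ‖⟪B (stdBasis E i), A (stdBasis E i)⟫_ℂ‖ ≤ hsSq B + hsSq A := by
  unfold hsSq
  rw [← ENNReal.tsum_add]
  refine ENNReal.tsum_le_tsum fun i => ?_
  rw [← ENNReal.ofReal_add (by positivity) (by positivity)]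
  refine ENNReal.ofReal_le_ofReal ((norm_inner_le_norm _ _).trans ?_)
  nlinarith [sq_nonneg (‖B (stdBasis E i)‖ - ‖A (stdBasis E i)‖), sq_nonneg (‖B (stdBasis E i)‖),
    sq_nonneg (‖A (stdBasis E i)‖)]

/-- `∑ |⟪eᵢ, M T N eᵢ⟫| < ∞` for trace-class `T` and bounded `M`, `N`. -/
theorem sum_conj_lt_top {T : E →L[ℂ] E} (hT : IsTraceClass T) (M : E →L[ℂ] F) (N : F →L[ℂ] E) :
    ∑' i, ENNReal.ofReal ‖⟪stdBasis F i, (M ∘L T ∘L N) (stdBasis F i)⟫_ℂ‖ < ∞ := by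
  obtain ⟨U, -, hU, -⟩ := exists_polar T
  obtain ⟨R, hR, hRR, hn⟩ := exists_sqrt T
  have hfin : hsSq R < ∞ := by rw [← hn]; exact hT
  have h : ∀ x, ⟪x, (M ∘L T ∘L N) x⟫_ℂ = ⟪(R ∘L adjoint (M ∘L U)) x, (R ∘L N) x⟫_ℂ := by
    intro x
    have : T (N x) = U (R (R (N x))) := by
      conv_lhs => rw [hU, ← hRR]
      rfl
    simp only [ContinuousLinearMap.comp_apply]
    rw [this, ← ContinuousLinearMap.adjoint_inner_right R, hR,
      ContinuousLinearMap.adjoint_inner_left]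
    rfl
  simp_rw [h]
  refine (sum_inner_le _ _).trans_lt (ENNReal.add_lt_top.2 ⟨?_, ?_⟩)
  · exact (hsSq_comp_le' _ _).trans_lt (ENNReal.mul_lt_top ENNReal.ofReal_lt_top hfin)
  · exact (hsSq_comp_le' _ _).trans_lt (ENNReal.mul_lt_top ENNReal.ofReal_lt_top hfin)

theorem IsTraceClass.zero : IsTraceClass (0 : E →L[ℂ] E) := by
  simp [IsTraceClass, traceNorm]

theorem IsTraceClass.smul (c : ℂ) {T : E →L[ℂ] E} (hT : IsTraceClass T) :
    IsTraceClass (c • T) := by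
  have h : traceNorm (c • T) = ENNReal.ofReal ‖c‖ * traceNorm T := by
    unfold traceNorm
    rw [← ENNReal.tsum_mul_left]
    refine tsum_congr fun i => ?_
    rw [← ENNReal.ofReal_mul (norm_nonneg c), CFC.abs_smul, smul_apply,
      inner_smul_right_eq_smul]
    simp
  rw [IsTraceClass, h]
  exact ENNReal.mul_lt_top ENNReal.ofReal_lt_top hT

theorem IsTraceClass.add {S T : E →L[ℂ] E} (hS : IsTraceClass S) (hT : IsTraceClass T) :
    IsTraceClass (S + T) := by
  obtain ⟨W, -, -, hW⟩ := exists_polar (S + T)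
  have h1 := sum_conj_lt_top hS (adjoint W) (.id ℂ E)
  have h2 := sum_conj_lt_top hT (adjoint W) (.id ℂ E)
  refine lt_of_le_of_lt ?_ (ENNReal.add_lt_top.2 ⟨h1, h2⟩)
  rw [← ENNReal.tsum_add]
  refine ENNReal.tsum_le_tsum fun i => ?_
  rw [← ENNReal.ofReal_add (by positivity) (by positivity)]
  refine ENNReal.ofReal_le_ofReal ?_
  rw [hW]
  simp only [ContinuousLinearMap.comp_apply, add_apply, map_add,
    inner_add_right, ContinuousLinearMap.id_apply]
  exact add_le_add (RCLike.re_le_norm _) (RCLike.re_le_norm _)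

theorem IsTraceClass.conj (A : E →L[ℂ] F) {T : E →L[ℂ] E} (hT : IsTraceClass T) :
    IsTraceClass (A ∘L T ∘L adjoint A) := by
  obtain ⟨W, -, -, hW⟩ := exists_polar (A ∘L T ∘L adjoint A)
  refine lt_of_le_of_lt ?_ (sum_conj_lt_top hT (adjoint W ∘L A) (adjoint A))
  refine ENNReal.tsum_le_tsum fun i => ENNReal.ofReal_le_ofReal ?_
  rw [hW]
  exact RCLike.re_le_norm _

end Helpers

/-- The complex vector space of trace-class operators on `H`. -/
def TraceClass (H : Type*) [NormedAddCommGroup H] [InnerProductSpace ℂ H] [CompleteSpace H] :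
    Submodule ℂ (H →L[ℂ] H) where
  carrier := {T | IsTraceClass T}
  add_mem' := IsTraceClass.add
  zero_mem' := IsTraceClass.zero
  smul_mem' c _ hT := hT.smul c

/-- `A T A*` as a trace-class operator. -/
def conjTC {E F : Type*} [NormedAddCommGroup E] [InnerProductSpace ℂ E] [CompleteSpace E]
    [NormedAddCommGroup F] [InnerProductSpace ℂ F] [CompleteSpace F]
    (A : E →L[ℂ] F) (T : TraceClass E) : TraceClass F :=
  ⟨A ∘L (T : E →L[ℂ] E) ∘L ContinuousLinearMap.adjoint A, IsTraceClass.conj A T.2⟩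

/-! ### Quantum operations -/

/-- `Ψ` is the dual of `Φ`: `tr (Ψ(X) T) = tr (X Φ(T))` for all trace-class `T` and bounded `X`. -/
def IsDual {H₁ H₂ : Type*}
    [NormedAddCommGroup H₁] [InnerProductSpace ℂ H₁] [CompleteSpace H₁]
    [NormedAddCommGroup H₂] [InnerProductSpace ℂ H₂] [CompleteSpace H₂]
    (Φ : TraceClass H₁ →ₗ[ℂ] TraceClass H₂) (Ψ : (H₂ →L[ℂ] H₂) →ₗ[ℂ] (H₁ →L[ℂ] H₁)) : Prop :=
  ∀ (T : TraceClass H₁) (X : H₂ →L[ℂ] H₂),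
    trace (Ψ X ∘L (T : H₁ →L[ℂ] H₁)) = trace (X ∘L (Φ T : H₂ →L[ℂ] H₂))

/-- The ultraweak topology on `B(H)`: the coarsest topology for which `X ↦ tr (X T)` is continuous
for every trace-class `T`. -/
@[reducible] def ultraweak (H : Type*) [NormedAddCommGroup H] [InnerProductSpace ℂ H] [CompleteSpace H] :
    TopologicalSpace (H →L[ℂ] H) :=
  ⨅ T : TraceClass H,
    TopologicalSpace.induced (fun X : H →L[ℂ] H => trace (X ∘L (T : H →L[ℂ] H))) inferInstance

/-- A linear map between algebras of bounded operators is normal if it is ultraweakly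
continuous. -/
def IsNormalMap {H₁ H₂ : Type*}
    [NormedAddCommGroup H₁] [InnerProductSpace ℂ H₁] [CompleteSpace H₁]
    [NormedAddCommGroup H₂] [InnerProductSpace ℂ H₂] [CompleteSpace H₂]
    (Ψ : (H₂ →L[ℂ] H₂) →ₗ[ℂ] (H₁ →L[ℂ] H₁)) : Prop :=
  @Continuous _ _ (ultraweak H₂) (ultraweak H₁) Ψ

/-- A quantum operation: a linear map between the spaces of trace-class operators, bounded for the
trace norm, whose dual is normal and completely positive. -/
structure IsQuantumOperation {H₁ H₂ : Type*}
    [NormedAddCommGroup H₁] [InnerProductSpace ℂ H₁] [CompleteSpace H₁]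
    [NormedAddCommGroup H₂] [InnerProductSpace ℂ H₂] [CompleteSpace H₂]
    (Φ : TraceClass H₁ →ₗ[ℂ] TraceClass H₂) : Prop where
  bounded : ∃ C : ℝ≥0, ∀ T : TraceClass H₁,
    traceNorm (Φ T : H₂ →L[ℂ] H₂) ≤ C * traceNorm (T : H₁ →L[ℂ] H₁)
  dual_normal_cp : ∃ Ψ : CompletelyPositiveMap (H₂ →L[ℂ] H₂) (H₁ →L[ℂ] H₁),
    IsDual Φ Ψ.toLinearMap ∧ IsNormalMap Ψ.toLinearMap

/-! ### Hilbert tensor products and Stinespring representations -/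

/-- The Hilbert space tensor product: the completion of the algebraic tensor product for the inner
product with `⟪x ⊗ y, x' ⊗ y'⟫ = ⟪x, x'⟫ ⟪y, y'⟫`. -/
abbrev HilbertTensor (E F : Type*) [NormedAddCommGroup E] [InnerProductSpace ℂ E]
    [NormedAddCommGroup F] [InnerProductSpace ℂ F] : Type _ :=
  UniformSpace.Completion (E ⊗[ℂ] F)

/-- The bounded operator `X ⊗ Y` on Hilbert space tensor products. -/
def opTensor {E E' F F' : Type*}
    [NormedAddCommGroup E] [InnerProductSpace ℂ E] [NormedAddCommGroup E'] [InnerProductSpace ℂ E']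
    [NormedAddCommGroup F] [InnerProductSpace ℂ F] [NormedAddCommGroup F'] [InnerProductSpace ℂ F']
    (X : E →L[ℂ] E') (Y : F →L[ℂ] F') : HilbertTensor E F →L[ℂ] HilbertTensor E' F' :=
  (TensorProduct.mapL X Y).completion

/-- `R = tr_K S`: the partial trace of the trace-class operator `S` on `H ⊗ K` over `K` is the
unique trace-class operator `R` on `H` with `tr (X R) = tr ((X ⊗ I) S)` for every bounded `X`. -/
def IsPartialTrace {H K : Type*}
    [NormedAddCommGroup H] [InnerProductSpace ℂ H] [CompleteSpace H]
    [NormedAddCommGroup K] [InnerProductSpace ℂ K]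
    (S : TraceClass (HilbertTensor H K)) (R : TraceClass H) : Prop :=
  ∀ X : H →L[ℂ] H, trace (X ∘L (R : H →L[ℂ] H)) =
    trace (opTensor X (.id ℂ K) ∘L (S : HilbertTensor H K →L[ℂ] HilbertTensor H K))

/-- `(K, A)` is a Stinespring representation of `Φ`: `Φ(T) = tr_K (A T A*)` for all `T`. -/
def IsStinespring {H₁ H₂ K : Type*}
    [NormedAddCommGroup H₁] [InnerProductSpace ℂ H₁] [CompleteSpace H₁]
    [NormedAddCommGroup H₂] [InnerProductSpace ℂ H₂] [CompleteSpace H₂]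
    [NormedAddCommGroup K] [InnerProductSpace ℂ K]
    (Φ : TraceClass H₁ →ₗ[ℂ] TraceClass H₂) (A : H₁ →L[ℂ] HilbertTensor H₂ K) : Prop :=
  ∀ T : TraceClass H₁, IsPartialTrace (conjTC A T) (Φ T)

/-- Minimality of `(K, A)`: the vectors `(X ⊗ I) A h` span a dense subspace of `H₂ ⊗ K`. -/
def IsMinimal {H₁ H₂ K : Type*}
    [NormedAddCommGroup H₁] [InnerProductSpace ℂ H₁]
    [NormedAddCommGroup H₂] [InnerProductSpace ℂ H₂]
    [NormedAddCommGroup K] [InnerProductSpace ℂ K]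
    (A : H₁ →L[ℂ] HilbertTensor H₂ K) : Prop :=
  (Submodule.span ℂ {z : HilbertTensor H₂ K | ∃ (X : H₂ →L[ℂ] H₂) (h : H₁),
    z = opTensor X (.id ℂ K) (A h)}).topologicalClosure = ⊤

/-- A partial isometry: isometric on the orthogonal complement of its kernel. -/
def IsPartialIsometry {E F : Type*} [NormedAddCommGroup E] [InnerProductSpace ℂ E]
    [NormedAddCommGroup F] [InnerProductSpace ℂ F] (W : E →L[ℂ] F) : Prop :=
  ∀ x ∈ (LinearMap.ker W.toLinearMap)ᗮ, ‖W x‖ = ‖x‖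

end

end QOp

open QOp

namespace QOp

noncomputable section

open ContinuousLinearMap (adjoint)
open InnerProductSpace (rankOne)

/-! ### Rank-one operators -/

section RankOne

variable {E F : Type*} [NormedAddCommGroup E] [InnerProductSpace ℂ E] [CompleteSpace E]
  [NormedAddCommGroup F] [InnerProductSpace ℂ F] [CompleteSpace F]

/-! Everything is read off from the slices `(⟨e| ⊗ I) A g ∈ K`. Testing the Stinespring identity on
`T = |h⟩⟨g|` gives `⟪A g, (X ⊗ I) A h⟫ = tr (X Φ(|h⟩⟨g|))`, whose right side does not mention `K`
(`IsStinespring.inner_opTensor`). For `X = |e⟩⟨f|` the left side is the inner product of two slices,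
so any two representations of `Φ` have slice families with the same Gram matrix
(`IsStinespring.inner_slice_eq`).

Equal Gram matrices yield a partial isometry `W` carrying one family to the other, with `W*`
carrying it back (`exists_partialIsometry_of_gram_eq`). Slices separate vectors and intertwine `I ⊗
W` with `W`, so these relations become `A' = (I ⊗ W) A` and `A = (I ⊗ W*) A'`. In the minimal case
`V* V` fixes every slice of the minimal representation, which forces `V* V = I`
(`IsMinimal.eq_id_of_slice`); if both are minimal, the same holds for `V V*`. -/

theorem inner_stdBasis_rankOne (u v : E) (i : basisSet E) :
    ⟪stdBasis E i, rankOne ℂ u v (stdBasis E i)⟫_ℂ =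
      ⟪v, stdBasis E i⟫_ℂ * ⟪stdBasis E i, u⟫_ℂ := by
  rw [InnerProductSpace.rankOne_apply, inner_smul_right]

theorem trace_rankOne (u v : E) : trace (rankOne ℂ u v) = ⟪v, u⟫_ℂ := by
  simp_rw [trace, inner_stdBasis_rankOne]
  exact ((stdBasis E).hasSum_inner_mul_inner v u).tsum_eq

/-- By polar decomposition `|T| = U* T` is again rank one, namely `|U* u⟩⟨v|`. Its diagonal entries
are products of coefficients of `v` and `U* u`, summable by `ab ≤ a² + b²` and Parseval. -/
theorem IsTraceClass.rankOne (u v : E) : IsTraceClass (rankOne ℂ u v) := by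
  obtain ⟨U, -, -, hU⟩ := exists_polar (InnerProductSpace.rankOne ℂ u v)
  rw [InnerProductSpace.comp_rankOne] at hU
  have h : ENNReal.ofReal (‖v‖ ^ 2) + ENNReal.ofReal (‖adjoint U u‖ ^ 2) < ∞ :=
    ENNReal.add_lt_top.2 ⟨ENNReal.ofReal_lt_top, ENNReal.ofReal_lt_top⟩
  refine lt_of_le_of_lt ?_ h
  rw [parseval v, parseval (adjoint U u), ← ENNReal.tsum_add]
  refine ENNReal.tsum_le_tsum fun i => ?_
  rw [← ENNReal.ofReal_add (by positivity) (by positivity), hU, inner_stdBasis_rankOne]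
  refine ENNReal.ofReal_le_ofReal ((RCLike.re_le_norm _).trans ?_)
  rw [norm_mul, norm_inner_symm]
  nlinarith [sq_nonneg (‖⟪stdBasis E i, v⟫_ℂ‖ - ‖⟪stdBasis E i, adjoint U u⟫_ℂ‖),
    sq_nonneg ‖⟪stdBasis E i, v⟫_ℂ‖, sq_nonneg ‖⟪stdBasis E i, adjoint U u⟫_ℂ‖]

theorem conj_rankOne (A : E →L[ℂ] F) (u v : E) :
    A ∘L rankOne ℂ u v ∘L adjoint A = rankOne ℂ (A u) (A v) := by
  ext x
  simp [ContinuousLinearMap.adjoint_inner_right]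

end RankOne

/-! ### Slice maps -/

section Slice

variable {H H' K K' : Type*} [NormedAddCommGroup H] [InnerProductSpace ℂ H]
  [NormedAddCommGroup H'] [InnerProductSpace ℂ H']
  [NormedAddCommGroup K] [InnerProductSpace ℂ K]
  [NormedAddCommGroup K'] [InnerProductSpace ℂ K']

/-- The operator `k ↦ e ⊗ k`. -/
def tensorLeft (K : Type*) [NormedAddCommGroup K] [InnerProductSpace ℂ K] (e : H) :
    K →L[ℂ] HilbertTensor H K :=
  UniformSpace.Completion.toComplL ∘L TensorProduct.mkL ℂ H K e

theorem tensorLeft_apply (e : H) (k : K) :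
    tensorLeft K e k = ((e ⊗ₜ[ℂ] k : H ⊗[ℂ] K) : HilbertTensor H K) := rfl

theorem opTensor_tensorLeft (X : H →L[ℂ] H') (Y : K →L[ℂ] K') (e : H) (k : K) :
    opTensor X Y (tensorLeft K e k) = tensorLeft K' (X e) (Y k) :=
  UniformSpace.Completion.map_coe (TensorProduct.mapL X Y).uniformContinuous _

/-- Continuous linear maps on a Hilbert tensor product agree if they agree on simple tensors. -/
theorem hilbertTensor_ext {G : Type*} [NormedAddCommGroup G] [NormedSpace ℂ G]
    {S T : HilbertTensor H K →L[ℂ] G}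
    (h : ∀ e k, S (tensorLeft K e k) = T (tensorLeft K e k)) : S = T := by
  ext z
  refine UniformSpace.Completion.induction_on z (isClosed_eq S.continuous T.continuous) fun t => ?_
  induction t using TensorProduct.induction_on with
  | zero => rw [UniformSpace.Completion.coe_zero, map_zero, map_zero]
  | tmul e k => exact h e k
  | add x y hx hy => rw [UniformSpace.Completion.coe_add, map_add, map_add, hx, hy]

variable [CompleteSpace K] [CompleteSpace K']

/-- The slice map `⟨e| ⊗ I`, the adjoint of `k ↦ e ⊗ k`. -/
def slice (K : Type*) [NormedAddCommGroup K] [InnerProductSpace ℂ K] [CompleteSpace K] (e : H) :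
    HilbertTensor H K →L[ℂ] K :=
  adjoint (tensorLeft K e)

theorem slice_tensorLeft (e f : H) (k : K) : slice K e (tensorLeft K f k) = ⟪e, f⟫_ℂ • k := by
  refine ext_inner_left ℂ fun l => ?_
  rw [slice, ContinuousLinearMap.adjoint_inner_right, tensorLeft_apply, tensorLeft_apply,
    UniformSpace.Completion.inner_coe, TensorProduct.inner_tmul, inner_smul_right]

theorem tensorLeft_comp_slice (e f : H) :
    tensorLeft K e ∘L slice K f = opTensor (rankOne ℂ e f) (.id ℂ K) := by
  refine hilbertTensor_ext fun x k => ?_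
  rw [ContinuousLinearMap.comp_apply, slice_tensorLeft, opTensor_tensorLeft, map_smul,
    InnerProductSpace.rankOne_apply, ContinuousLinearMap.id_apply, tensorLeft, tensorLeft]
  simp

theorem inner_slice_slice (e f : H) (z w : HilbertTensor H K) :
    ⟪slice K e z, slice K f w⟫_ℂ = ⟪z, opTensor (rankOne ℂ e f) (.id ℂ K) w⟫_ℂ := by
  rw [← tensorLeft_comp_slice, ContinuousLinearMap.comp_apply, slice,
    ContinuousLinearMap.adjoint_inner_left]

/-- The first factor only changes the index of the slice, while the second acts on the slice itself;
simple tensors suffice to check this. -/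
theorem slice_opTensor [CompleteSpace H] [CompleteSpace H'] (X : H →L[ℂ] H') (Y : K →L[ℂ] K')
    (e : H') (z : HilbertTensor H K) :
    slice K' e (opTensor X Y z) = Y (slice K (adjoint X e) z) := by
  have h : slice K' e ∘L opTensor X Y = Y ∘L slice K (adjoint X e) := by
    refine hilbertTensor_ext fun x k => ?_
    simp only [ContinuousLinearMap.comp_apply, opTensor_tensorLeft, slice_tensorLeft, map_smul,
      ContinuousLinearMap.adjoint_inner_left]
  exact DFunLike.congr_fun h z

/-- Pairing `z` with `e ⊗ k` is pairing its slice at `e` with `k`, and simple tensors are total. -/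
theorem ext_slice {z w : HilbertTensor H K} (h : ∀ e, slice K e z = slice K e w) : z = w := by
  have h' : innerSL ℂ z = innerSL ℂ w := by
    refine hilbertTensor_ext fun e k => ?_
    rw [innerSL_apply_apply, innerSL_apply_apply, ← ContinuousLinearMap.adjoint_inner_left,
      ← ContinuousLinearMap.adjoint_inner_left]
    exact congrArg (fun l => ⟪l, k⟫_ℂ) (h e)
  exact ext_inner_right ℂ fun v => DFunLike.congr_fun h' v

end Slice

/-! ### Stinespring representations with the same slices -/

section Families

variable {ι K K' : Type*} [NormedAddCommGroup K] [InnerProductSpace ℂ K] [CompleteSpace K]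
  [NormedAddCommGroup K'] [InnerProductSpace ℂ K'] [CompleteSpace K']

/-- Two families with the same Gram matrix are related by a partial isometry. -/
theorem exists_partialIsometry_of_gram_eq (x : ι → K) (y : ι → K')
    (h : ∀ i j, ⟪x i, x j⟫_ℂ = ⟪y i, y j⟫_ℂ) :
    ∃ W : K →L[ℂ] K', IsPartialIsometry W ∧ (∀ i, W (x i) = y i) ∧
      ∀ i, adjoint W (y i) = x i := by
  -- Formal combinations serve as a common domain: equal norms of `a u` and `b u` will make `a u ↦ b
  -- u` well defined and isometric.
  let a : (ι →₀ ℂ) →ₗ[ℂ] K := Finsupp.linearCombination ℂ x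
  let b : (ι →₀ ℂ) →ₗ[ℂ] K' := Finsupp.linearCombination ℂ y
  have hab : ∀ u v, ⟪a u, a v⟫_ℂ = ⟪b u, b v⟫_ℂ := fun u v => by
    simp only [a, b, Finsupp.linearCombination_apply, Finsupp.sum, sum_inner, inner_sum,
      inner_smul_left, inner_smul_right, h]
  have hnab : ∀ u, ‖b u‖ = ‖a u‖ := fun u => by
    rw [norm_eq_sqrt_re_inner (𝕜 := ℂ), norm_eq_sqrt_re_inner (𝕜 := ℂ), hab]
  let M : Submodule ℂ K := (LinearMap.range a).topologicalClosure
  have : CompleteSpace M := (Submodule.isClosed_topologicalClosure _).completeSpace_coe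
  have hmem : ∀ u, a u ∈ M := fun u => Submodule.le_topologicalClosure _ ⟨u, rfl⟩
  let e : (ι →₀ ℂ) →ₗ[ℂ] M := a.codRestrict M hmem
  have hd : DenseRange e := by
    rw [DenseRange, Subtype.dense_iff]
    intro z hz
    have hr : ((fun s : M => (s : K)) '' Set.range e : Set K) = (LinearMap.range a : Set K) := by
      rw [← Set.range_comp]; rfl
    change z ∈ closure ((fun s : M => (s : K)) '' Set.range e)
    rw [hr]
    exact hz
  let W₀ : M →L[ℂ] K' := b.extendOfNorm e
  have hW₀ : ∀ u, W₀ (e u) = b u :=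
    LinearMap.extendOfNorm_eq hd ⟨1, fun u => by rw [one_mul]; exact (hnab u).le⟩
  have hWn : ∀ s : M, ‖W₀ s‖ = ‖s‖ := fun s =>
    hd.induction_on (p := fun s : M => ‖W₀ s‖ = ‖s‖) s
      (isClosed_eq (by fun_prop) (by fun_prop)) fun u => by rw [hW₀]; exact hnab u
  have hWi : ∀ (s : M) u, ⟪W₀ s, b u⟫_ℂ = ⟪(s : K), a u⟫_ℂ := fun s u =>
    hd.induction_on (p := fun s : M => ⟪W₀ s, b u⟫_ℂ = ⟪(s : K), a u⟫_ℂ) s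
      (isClosed_eq (by fun_prop) (by fun_prop)) fun v => by rw [hW₀]; exact (hab v u).symm
  -- Extension by zero on `Mᗮ`.
  let W : K →L[ℂ] K' := W₀ ∘L M.orthogonalProjectionOnto
  have hWM : ∀ s : M, W s = W₀ s := fun s => by
    simp only [W, ContinuousLinearMap.comp_apply,
      Submodule.orthogonalProjectionOnto_mem_subspace_eq_self]
  have hai : ∀ i, a (Finsupp.single i 1) = x i := fun i => by simp [a]
  have hbi : ∀ i, b (Finsupp.single i 1) = y i := fun i => by simp [b]
  refine ⟨W, fun z hz => ?_, fun i => ?_, fun i => ?_⟩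
  -- Since `W` vanishes on `Mᗮ` and `M` is closed, `(ker W)ᗮ ⊆ M`, where `W` is isometric.
  · have hker : Mᗮ ≤ LinearMap.ker W.toLinearMap := fun v hv => by
      have h0 : M.orthogonalProjectionOnto v = 0 :=
        Submodule.orthogonalProjectionOnto_eq_zero_iff.2 hv
      change W₀ (M.orthogonalProjectionOnto v) = 0
      rw [h0, map_zero]
    have hzM : z ∈ M := by
      rw [← Submodule.orthogonal_orthogonal M]
      exact Submodule.orthogonal_le hker hz
    exact (congrArg norm (hWM ⟨z, hzM⟩)).trans (hWn ⟨z, hzM⟩)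
  · rw [← hai, ← hbi, ← hW₀]
    exact hWM (e (Finsupp.single i 1))
  · refine ext_inner_left ℂ fun v => ?_
    rw [ContinuousLinearMap.adjoint_inner_right, ← hbi, ← hai]
    exact (hWi _ _).trans
      (Submodule.inner_orthogonalProjectionOnto_eq_of_mem_right ⟨_, hmem _⟩ v)

end Families

/-! ### Slices of representations of a common operation -/

section Stinespring

variable {H₁ H₂ K K' : Type*}
  [NormedAddCommGroup H₁] [InnerProductSpace ℂ H₁]
  [NormedAddCommGroup H₂] [InnerProductSpace ℂ H₂] [CompleteSpace H₂]
  [NormedAddCommGroup K] [InnerProductSpace ℂ K] [CompleteSpace K]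
  [NormedAddCommGroup K'] [InnerProductSpace ℂ K'] [CompleteSpace K']
  {A : H₁ →L[ℂ] HilbertTensor H₂ K} {A' : H₁ →L[ℂ] HilbertTensor H₂ K'}

theorem eq_opTensor_comp {W : K →L[ℂ] K'}
    (h : ∀ e g, W (slice K e (A g)) = slice K' e (A' g)) :
    A' = opTensor (.id ℂ H₂) W ∘L A := by
  ext1 g
  refine ext_slice fun e => ?_
  rw [ContinuousLinearMap.comp_apply, slice_opTensor, ← h, ContinuousLinearMap.adjoint_id,
    ContinuousLinearMap.id_apply]

/-- For a minimal representation, an operator fixing all slices is the identity. -/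
theorem IsMinimal.eq_id_of_slice [Nontrivial H₂] (hA : IsMinimal A) {T : K →L[ℂ] K}
    (h : ∀ e g, T (slice K e (A g)) = slice K e (A g)) : T = .id ℂ K := by
  obtain ⟨e, he⟩ := exists_ne (0 : H₂)
  have hT : T ∘L slice K e = slice K e := by
    -- On the dense span, the slice of `(X ⊗ I) A g` at `e` is the slice of `A g` at `X* e`, which
    -- `T` fixes.
    refine ContinuousLinearMap.ext_on
      ((Submodule.dense_iff_topologicalClosure_eq_top).2 hA) ?_
    rintro _ ⟨X, g, rfl⟩
    rw [ContinuousLinearMap.comp_apply, slice_opTensor, ContinuousLinearMap.id_apply, h]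
  ext k
  -- Slicing `e ⊗ k` at `e` returns `⟪e, e⟫ k`, a nonzero multiple of `k`, so every vector of `K` is
  -- reached.
  have hk := DFunLike.congr_fun hT (tensorLeft K e k)
  rw [ContinuousLinearMap.comp_apply, slice_tensorLeft, map_smul] at hk
  exact smul_right_injective K (inner_self_ne_zero.2 he) hk

variable [CompleteSpace H₁] {Φ : TraceClass H₁ →ₗ[ℂ] TraceClass H₂}

/-- For `T = |h⟩⟨g|`, the operator `(X ⊗ I) A T A*` is `|(X ⊗ I) A h⟩⟨A g|`, whose trace is an inner
product. -/
theorem IsStinespring.inner_opTensor (hA : IsStinespring Φ A) (X : H₂ →L[ℂ] H₂) (g h : H₁) :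
    ⟪A g, opTensor X (.id ℂ K) (A h)⟫_ℂ =
      trace (X ∘L (Φ ⟨rankOne ℂ h g, IsTraceClass.rankOne h g⟩ : H₂ →L[ℂ] H₂)) := by
  refine Eq.symm ((hA _ X).trans ?_)
  change trace (_ ∘L A ∘L rankOne ℂ h g ∘L adjoint A) = _
  rw [conj_rankOne, InnerProductSpace.comp_rankOne, trace_rankOne]

theorem IsStinespring.inner_slice_eq (hA : IsStinespring Φ A) (hA' : IsStinespring Φ A')
    (e f : H₂) (g h : H₁) :
    ⟪slice K e (A g), slice K f (A h)⟫_ℂ = ⟪slice K' e (A' g), slice K' f (A' h)⟫_ℂ := by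
  rw [inner_slice_slice, inner_slice_slice, hA.inner_opTensor, hA'.inner_opTensor]

theorem IsStinespring.exists_partialIsometry (hA : IsStinespring Φ A)
    (hA' : IsStinespring Φ A') :
    ∃ W : K →L[ℂ] K', IsPartialIsometry W ∧
      (∀ e g, W (slice K e (A g)) = slice K' e (A' g)) ∧
      ∀ e g, adjoint W (slice K' e (A' g)) = slice K e (A g) := by
  obtain ⟨W, h₁, h₂, h₃⟩ := exists_partialIsometry_of_gram_eq
    (fun p : H₂ × H₁ => slice K p.1 (A p.2)) (fun p : H₂ × H₁ => slice K' p.1 (A' p.2))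
    fun p q => hA.inner_slice_eq hA' p.1 q.1 p.2 q.2
  exact ⟨W, h₁, fun e g => h₂ (e, g), fun e g => h₃ (e, g)⟩

end Stinespring

end

end QOp

theorem theoremA1
    {H₁ H₂ Khat K K' : Type*}
    [NormedAddCommGroup H₁] [InnerProductSpace ℂ H₁] [CompleteSpace H₁]
    [TopologicalSpace.SeparableSpace H₁]
    [NormedAddCommGroup H₂] [InnerProductSpace ℂ H₂] [CompleteSpace H₂]
    [TopologicalSpace.SeparableSpace H₂]
    [NormedAddCommGroup Khat] [InnerProductSpace ℂ Khat] [CompleteSpace Khat]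
    [TopologicalSpace.SeparableSpace Khat]
    [NormedAddCommGroup K] [InnerProductSpace ℂ K] [CompleteSpace K]
    [TopologicalSpace.SeparableSpace K]
    [NormedAddCommGroup K'] [InnerProductSpace ℂ K'] [CompleteSpace K']
    [TopologicalSpace.SeparableSpace K']
    (Φ : TraceClass H₁ →ₗ[ℂ] TraceClass H₂) (hΦ : IsQuantumOperation Φ)
    (Ahat : H₁ →L[ℂ] HilbertTensor H₂ Khat)
    (A : H₁ →L[ℂ] HilbertTensor H₂ K) (hA : IsStinespring Φ A)
    (A' : H₁ →L[ℂ] HilbertTensor H₂ K') :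
    (Nontrivial H₂ → IsStinespring Φ Ahat → IsMinimal Ahat →
      ∃ V : Khat →L[ℂ] K, Isometry V ∧
        A = opTensor (.id ℂ H₂) V ∘L Ahat ∧
        Ahat = opTensor (.id ℂ H₂) (ContinuousLinearMap.adjoint V) ∘L A ∧
        (IsMinimal A →
          ContinuousLinearMap.adjoint V ∘L V = .id ℂ Khat ∧
          V ∘L ContinuousLinearMap.adjoint V = .id ℂ K)) ∧
    (IsStinespring Φ A' →
      ∃ W : K →L[ℂ] K', IsPartialIsometry W ∧
        A' = opTensor (.id ℂ H₂) W ∘L A ∧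
        A = opTensor (.id ℂ H₂) (ContinuousLinearMap.adjoint W) ∘L A') := by
  refine ⟨fun _ hAhat hmin => ?_, fun hA' => ?_⟩
  -- The partial isometry property can be dropped: `V* V = I` already makes `V` isometric.
  · obtain ⟨V, -, h₁, h₂⟩ := hAhat.exists_partialIsometry hA
    have hV : ContinuousLinearMap.adjoint V ∘L V = .id ℂ Khat :=
      hmin.eq_id_of_slice fun e g => by rw [ContinuousLinearMap.comp_apply, h₁, h₂]
    refine ⟨V, ?_, eq_opTensor_comp h₁, eq_opTensor_comp h₂, fun hminA => ⟨hV, ?_⟩⟩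
    · exact AddMonoidHomClass.isometry_of_norm V
        ((ContinuousLinearMap.norm_map_iff_adjoint_comp_self V).2 hV)
    · exact hminA.eq_id_of_slice fun e g => by rw [ContinuousLinearMap.comp_apply, h₂, h₁]
  · obtain ⟨W, hW, h₁, h₂⟩ := hA.exists_partialIsometry hA'
    exact ⟨W, hW, eq_opTensor_comp h₁, eq_opTensor_comp h₂⟩
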